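/- Let $n\ge 0$ and let $\epsilon=\epsilon_1\cdots\epsilon_n\in\{1,0,-1\}^n$. Let $\mathcal{N}(n;\epsilon)$ be the set of networks on the points $1,\dots,n$ of the following kind: a network is given by a set $\mathcal{E}$ of directed edges $(i,j)$ with $1\le i<j\le n$ such that - no point has both an incoming and an outgoing edge (a point is a source if it has an outgoing edge, a sink if it has an incoming edge, and neutral if it has no edges); - whenever $(i,k),(j,l)\in\mathcal{E}$ with $i<j<k<l$, also $(j,k)\in\mathcal{E}$; - the point $i$ is a source or neutral if $\epsilon_i=1$, a sink or neutral if $\epsilon_i=-1$, and neutral if $\epsilon_i=0$. Write $\mathcal{E}(x)$ for the edge set of a network $x$. Say that $y$ covers $x$, written $x\lessdot y$, if $\mathcal{E}(x)\subset\mathcal{E}(y)$ and $|\mathcal{E}(y)|=|\mathcal{E}(x)|+1$, and put $x\le y$ if there are networks $x=z_0\lessdot z_1\lessdot\cdots\lessdot z_r=y$ in $\mathcal{N}(n;\epsilon)$ with $r\ge 0$. Let $\mathcal{P}(n;\epsilon)=(\mathcal{N}(n;\epsilon),\le)$. A finite lattice $L$ is called supersolvable if it contains a maximal chain which together with any other chain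 of $L$ generates a distributive sublattice of $L$. **Corollary.** For all $x\le y$ in $\mathcal{P}(n;\epsilon)$, the interval $[x,y]$, with the order induced from $\mathcal{P}(n;\epsilon)$, is a supersolvable lattice. -/

import Mathlib

/-- A network on the points `0 < 1 < ⋯ < n - 1` (that is, on `Fin n`) satisfying the crossing
condition.  An edge `(i, j)` is directed from `i` to `j`; since the edges form a set, there is at
most one edge from `i` to `j`. -/
@[ext]
structure Network (n : ℕ) where
  /-- The set of directed edges. -/
  edges : Finset (Fin n × Fin n)
  /-- Edges go from left to right. -/
  lt_of_mem : ∀ i j, (i, j) ∈ edges → i < j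
  /-- No point has both an incoming and an outgoing edge, so each point is a source (outgoing
  edges only), a sink (incoming edges only) or neutral (no edges). -/
  not_source_and_sink : ∀ i j k, (i, j) ∈ edges → (j, k) ∉ edges
  /-- If the edges `(i, k)` and `(j, l)` cross, then `(j, k)` is an edge. -/
  crossing : ∀ i j k l, i < j → j < k → k < l →
    (i, k) ∈ edges → (j, l) ∈ edges → (j, k) ∈ edges

namespace Network

variable {n : ℕ}

/-- The point `i` has at least one outgoing edge. -/
def IsSource (N : Network n) (i : Fin n) : Prop := ∃ j, (i, j) ∈ N.edges

/-- The point `i` has at least one incoming edge. -/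
def IsSink (N : Network n) (i : Fin n) : Prop := ∃ j, (j, i) ∈ N.edges

/-- The point `i` has no edges at all. -/
def IsNeutral (N : Network n) (i : Fin n) : Prop := ¬ N.IsSource i ∧ ¬ N.IsSink i

/-- The number of edges. -/
def rho (N : Network n) : ℕ := N.edges.card

/-- The sources, sinks and neutral points of `N` are placed as prescribed by `ε`: a point `i` is a
source or neutral if `ε i = 1`, a sink or neutral if `ε i = -1`, and neutral if `ε i = 0`. -/
def HasType (N : Network n) (ε : Fin n → SignType) : Prop :=
  ∀ i, (ε i = 1 → N.IsSource i ∨ N.IsNeutral i) ∧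
    (ε i = -1 → N.IsSink i ∨ N.IsNeutral i) ∧
    (ε i = 0 → N.IsNeutral i)

end Network

/-- The underlying set `𝒩(n; ε)` of the poset `𝒫(n; ε)`: the networks of type `ε`. -/
@[ext]
structure NetworkPoset (n : ℕ) (ε : Fin n → SignType) extends Network n where
  hasType : toNetwork.HasType ε

namespace NetworkPoset

variable {n : ℕ} {ε : Fin n → SignType}

/-- `x ⋖ y`: the network `y` has exactly one more edge than `x`, and contains all edges of `x`. -/
def Covers (x y : NetworkPoset n ε) : Prop :=
  y.toNetwork.rho = x.toNetwork.rho + 1 ∧ x.edges ⊆ y.edges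

/-- `x ≤ y` if there is a sequence `x = z₀ ⋖ z₁ ⋖ ⋯ ⋖ zᵣ = y` in `𝒩(n; ε)` with `r ≥ 0`. -/
instance : LE (NetworkPoset n ε) := ⟨Relation.ReflTransGen Covers⟩

theorem edges_subset_of_le {x y : NetworkPoset n ε} (h : x ≤ y) : x.edges ⊆ y.edges := by
  change Relation.ReflTransGen Covers x y at h
  induction h with
  | refl => exact Finset.Subset.refl _
  | tail _ hc ih => exact ih.trans hc.2

/-- The poset `𝒫(n; ε)`. -/
instance : PartialOrder (NetworkPoset n ε) where
  le_refl _ := Relation.ReflTransGen.refl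
  le_trans _ _ _ := Relation.ReflTransGen.trans
  le_antisymm _ _ hxy hyx := NetworkPoset.ext
    (Finset.Subset.antisymm (edges_subset_of_le hxy) (edges_subset_of_le hyx))

end NetworkPoset

/-- The sublattice of `L` generated by `s` is distributive. -/
def GeneratesDistributive {L : Type*} [Lattice L] (s : Set L) : Prop :=
  ∀ a ∈ latticeClosure s, ∀ b ∈ latticeClosure s, ∀ c ∈ latticeClosure s,
    a ⊓ (b ⊔ c) = (a ⊓ b) ⊔ (a ⊓ c)

/-- A finite lattice is supersolvable if it contains a maximal chain `M` which together with any
other chain generates a distributive sublattice. -/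
def IsSupersolvable (L : Type*) [Lattice L] : Prop :=
  Finite L ∧ ∃ M : Set L, IsMaxChain (· ≤ ·) M ∧
    ∀ D : Set L, IsChain (· ≤ ·) D → GeneratesDistributive (M ∪ D)

/-- The partially ordered set `P` is a lattice, and this lattice is supersolvable. -/
def IsSupersolvableLattice (P : Type*) [PartialOrder P] : Prop :=
  ∃ L : Lattice P, L.toPartialOrder = ‹PartialOrder P› ∧ @IsSupersolvable P L

namespace NetworkPoset

variable {n : ℕ} {ε : Fin n → SignType}

/-! The edge `(j, k)` forced by a crossing pair `(i, k)`, `(j, l)` ranks below both. Hence `≤` is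
inclusion of edge sets (`le_of_edges_subset`), meets in `[x, y]` are intersections, and adding to
`x` the edges of `y` in order of rank gives a maximal chain. For any chain `D`, both chains lie in a
family of edge sets closed under union and intersection, all of whose members satisfy the crossing
condition (`IsDownClosed.crossingClosed`). Joins there are unions, so distributivity is that of
sets. -/

/-- The rank of an edge: edges are compared by their targets from left to right, and edges with the
same target by their sources from right to left. -/
def edgeRank (e : Fin n × Fin n) : Fin n ×ₗ (Fin n)ᵒᵈ := toLex (e.2, OrderDual.toDual e.1)

theorem edgeRank_injective : Function.Injective (edgeRank (n := n)) := by
  rintro ⟨a, b⟩ ⟨c, d⟩ h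
  have h' := toLex.injective h
  rw [Prod.mk.injEq] at h'
  exact Prod.ext (OrderDual.toDual.injective h'.2) h'.1

theorem edgeRank_lt_left {i j k : Fin n} (h : i < j) : edgeRank (j, k) < edgeRank (i, k) :=
  Prod.Lex.toLex_lt_toLex.2 (Or.inr ⟨rfl, OrderDual.toDual_lt_toDual.2 h⟩)

theorem edgeRank_lt_right {j k l : Fin n} (h : k < l) : edgeRank (j, k) < edgeRank (j, l) :=
  Prod.Lex.toLex_lt_toLex.2 (Or.inl h)

/-- The crossing condition for a set of edges. -/
def CrossingClosed (s : Finset (Fin n × Fin n)) : Prop :=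
  ∀ i j k l, i < j → j < k → k < l → (i, k) ∈ s → (j, l) ∈ s → (j, k) ∈ s

/-- The network given by a set of edges of `y` that satisfies the crossing condition. -/
def ofSubset (y : NetworkPoset n ε) (s : Finset (Fin n × Fin n)) (hs : s ⊆ y.edges)
    (hc : CrossingClosed s) : NetworkPoset n ε where
  edges := s
  lt_of_mem i j h := y.lt_of_mem i j (hs h)
  not_source_and_sink i j k h h' := y.not_source_and_sink i j k (hs h) (hs h')
  crossing := hc
  hasType i := by
    have hsrc : (∃ j, (i, j) ∈ s) → y.IsSource i := fun ⟨j, hj⟩ => ⟨j, hs hj⟩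
    have hsnk : (∃ j, (j, i) ∈ s) → y.IsSink i := fun ⟨j, hj⟩ => ⟨j, hs hj⟩
    have hns : ¬ (y.IsSource i ∧ y.IsSink i) :=
      fun ⟨⟨j, hj⟩, ⟨k, hk⟩⟩ => y.not_source_and_sink k i j hk hj
    have ht := y.hasType i
    simp only [Network.IsNeutral] at ht ⊢
    change (_ → (∃ j, (i, j) ∈ s) ∨ (¬ (∃ j, (i, j) ∈ s)) ∧ ¬ (∃ j, (j, i) ∈ s)) ∧
      (_ → (∃ j, (j, i) ∈ s) ∨ (¬ (∃ j, (i, j) ∈ s)) ∧ ¬ (∃ j, (j, i) ∈ s)) ∧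
      (_ → (¬ (∃ j, (i, j) ∈ s)) ∧ ¬ (∃ j, (j, i) ∈ s))
    tauto

theorem ext_edges {x y : NetworkPoset n ε} (h : x.edges = y.edges) : x = y :=
  NetworkPoset.ext h

/-- Edges of `y` outside `x` can be removed one at a time, highest rank first. -/
theorem le_of_edges_subset {x y : NetworkPoset n ε} (h : x.edges ⊆ y.edges) : x ≤ y := by
  induction hm : (y.edges \ x.edges).card generalizing y with
  | zero =>
    have : y.edges ⊆ x.edges := Finset.sdiff_eq_empty_iff_subset.1 (Finset.card_eq_zero.1 hm)
    exact (ext_edges (h.antisymm this)).le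
  | succ m ih =>
    obtain ⟨e, he, hmax⟩ := (y.edges \ x.edges).exists_max_image edgeRank
      (Finset.card_pos.1 (by omega))
    obtain ⟨hey, hex⟩ := Finset.mem_sdiff.1 he
    have hx_of_lt : ∀ f ∈ y.edges, edgeRank e < edgeRank f → f ∈ x.edges := fun f hf hlt => by
      by_contra hfx
      exact (hmax f (Finset.mem_sdiff.2 ⟨hf, hfx⟩)).not_gt hlt
    have hc : CrossingClosed (y.edges.erase e) := by
      intro i j k l hij hjk hkl h1 h2
      have h1' := Finset.mem_of_mem_erase h1
      have h2' := Finset.mem_of_mem_erase h2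
      refine Finset.mem_erase.2 ⟨?_, y.crossing i j k l hij hjk hkl h1' h2'⟩
      -- Both edges forcing `e` outrank it, so by maximality they lie in `x`, and then so does `e`.
      rintro rfl
      exact hex (x.crossing i j k l hij hjk hkl (hx_of_lt _ h1' (edgeRank_lt_left hij))
        (hx_of_lt _ h2' (edgeRank_lt_right hkl)))
    let z := y.ofSubset _ (Finset.erase_subset e y.edges) hc
    have hxz : x.edges ⊆ z.edges := Finset.subset_erase.2 ⟨h, hex⟩
    have hcard : (z.edges \ x.edges).card = m := by
      change (y.edges.erase e \ x.edges).card = m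
      rw [Finset.erase_sdiff_comm, Finset.card_erase_of_mem he, hm, Nat.add_sub_cancel]
    refine Relation.ReflTransGen.tail (ih hxz hcard) ⟨?_, Finset.erase_subset e y.edges⟩
    exact (Finset.card_erase_add_one hey).symm

theorem le_iff_edges_subset {x y : NetworkPoset n ε} : x ≤ y ↔ x.edges ⊆ y.edges :=
  ⟨edges_subset_of_le, le_of_edges_subset⟩

instance : Finite (NetworkPoset n ε) :=
  Finite.of_injective (fun x : NetworkPoset n ε => x.edges) fun _ _ => ext_edges

section Interval

variable {x y : NetworkPoset n ε}

/-- The element of the interval `[x, y]` with a given set of edges. -/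
def ofEdges (s : Finset (Fin n × Fin n)) (hx : x.edges ⊆ s) (hy : s ⊆ y.edges)
    (hc : CrossingClosed s) : Set.Icc x y :=
  ⟨y.ofSubset s hy hc, le_of_edges_subset hx, le_of_edges_subset hy⟩

theorem lower_subset (z : Set.Icc x y) : x.edges ⊆ z.1.edges := edges_subset_of_le z.2.1

theorem subset_upper (z : Set.Icc x y) : z.1.edges ⊆ y.edges := edges_subset_of_le z.2.2

theorem Icc_le_iff {a b : Set.Icc x y} : a ≤ b ↔ a.1.edges ⊆ b.1.edges := le_iff_edges_subset

open Classical in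
theorem exists_isGLB (hxy : x ≤ y) (S : Set (Set.Icc x y)) : ∃ a, IsGLB S a := by
  let s := y.edges.filter fun e => ∀ z ∈ S, e ∈ z.1.edges
  have hs : ∀ {e}, e ∈ s ↔ e ∈ y.edges ∧ ∀ z ∈ S, e ∈ z.1.edges := Finset.mem_filter
  have hc : CrossingClosed s := fun i j k l hij hjk hkl h1 h2 =>
    hs.2 ⟨y.crossing i j k l hij hjk hkl (hs.1 h1).1 (hs.1 h2).1, fun z hz =>
      z.1.crossing i j k l hij hjk hkl ((hs.1 h1).2 z hz) ((hs.1 h2).2 z hz)⟩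
  refine ⟨ofEdges s (fun e he => hs.2 ⟨edges_subset_of_le hxy he, fun z _ => lower_subset z he⟩)
    (Finset.filter_subset _ _) hc, fun z hz => Icc_le_iff.2 fun e he => (hs.1 he).2 z hz, ?_⟩
  exact fun b hb => Icc_le_iff.2 fun e he =>
    hs.2 ⟨subset_upper b he, fun z hz => Icc_le_iff.1 (hb hz) he⟩

/-- The lattice structure on the interval `[x, y]`. -/
noncomputable abbrev iccLattice (hxy : x ≤ y) : Lattice (Set.Icc x y) :=
  letI : InfSet (Set.Icc x y) := ⟨fun S => (exists_isGLB hxy S).choose⟩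
  (completeLatticeOfInf (Set.Icc x y) fun S => (exists_isGLB hxy S).choose_spec).toLattice

/-- The elements of `[x, y]` that arise from `x` by adding an initial segment of the edges of `y`
with respect to the rank. -/
def initialSegments (x y : NetworkPoset n ε) : Set (Set.Icc x y) :=
  {z | ∀ e ∈ z.1.edges, e ∉ x.edges → ∀ f ∈ y.edges, edgeRank f ≤ edgeRank e → f ∈ z.1.edges}

-- The element just before `e` enters; it tests maximality of the chain.
open Classical in
theorem exists_mem_initialSegments (hxy : x ≤ y) (e : Fin n × Fin n) :
    ∃ m ∈ initialSegments x y, ∀ f, f ∈ m.1.edges ↔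
      f ∈ y.edges ∧ (f ∈ x.edges ∨ edgeRank f < edgeRank e) := by
  let s := y.edges.filter fun f => f ∈ x.edges ∨ edgeRank f < edgeRank e
  have hs : ∀ {f}, f ∈ s ↔ f ∈ y.edges ∧ (f ∈ x.edges ∨ edgeRank f < edgeRank e) :=
    Finset.mem_filter
  have hc : CrossingClosed s := by
    intro i j k l hij hjk hkl h1 h2
    obtain ⟨h1y, h1⟩ := hs.1 h1
    obtain ⟨h2y, h2⟩ := hs.1 h2
    refine hs.2 ⟨y.crossing i j k l hij hjk hkl h1y h2y, ?_⟩
    rcases h1 with h1 | h1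
    · rcases h2 with h2 | h2
      · exact Or.inl (x.crossing i j k l hij hjk hkl h1 h2)
      · exact Or.inr ((edgeRank_lt_right hkl).trans h2)
    · exact Or.inr ((edgeRank_lt_left hij).trans h1)
  refine ⟨ofEdges s (fun f hf => hs.2 ⟨edges_subset_of_le hxy hf, Or.inl hf⟩)
    (Finset.filter_subset _ _) hc, ?_, fun f => hs⟩
  intro f hf hfx g hg hgf
  exact hs.2 ⟨hg, Or.inr (hgf.trans_lt ((hs.1 hf).2.resolve_left hfx))⟩

theorem isMaxChain_initialSegments (hxy : x ≤ y) :
    IsMaxChain (· ≤ ·) (initialSegments x y) := by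
  constructor
  · intro a ha b hb _
    by_contra! h
    obtain ⟨e, hea, heb⟩ := Finset.not_subset.1 (fun hs => h.1 (Icc_le_iff.2 hs))
    obtain ⟨f, hfb, hfa⟩ := Finset.not_subset.1 (fun hs => h.2 (Icc_le_iff.2 hs))
    rcases le_total (edgeRank e) (edgeRank f) with hef | hfe
    · exact heb (hb f hfb (fun hx => hfa (lower_subset a hx)) e (subset_upper a hea) hef)
    · exact hfa (ha e hea (fun hx => heb (lower_subset b hx)) f (subset_upper b hfb) hfe)
  · refine fun T hT hsub => hsub.antisymm fun z hz e he hex f hf hfe => ?_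
    -- `m` omits `e`, so a comparable `z` containing `e` must lie above `m` and contain every edge
    -- of `y` ranked below `e`.
    obtain ⟨m, hm, hmem⟩ := exists_mem_initialSegments hxy e
    rcases hfe.eq_or_lt with heq | hlt
    · rwa [edgeRank_injective heq]
    · rcases hT.total (hsub hm) hz with h | h
      · exact Icc_le_iff.1 h ((hmem f).2 ⟨hf, Or.inr hlt⟩)
      · exact absurd (((hmem e).1 (Icc_le_iff.1 h he)).2.resolve_left hex) (lt_irrefl _)

/-- A set of edges that is closed, among the edges of `y` outside `x`, under passing from `e` to any
edge of smaller rank that lies in all those members of `D` that contain `e`. -/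
def IsDownClosed (D : Set (Set.Icc x y)) (s : Finset (Fin n × Fin n)) : Prop :=
  ∀ e ∈ s, e ∉ x.edges → ∀ f ∈ y.edges, edgeRank f ≤ edgeRank e →
    (∀ d ∈ D, e ∈ d.1.edges → f ∈ d.1.edges) → f ∈ s

theorem IsDownClosed.union {D : Set (Set.Icc x y)} {s t : Finset (Fin n × Fin n)}
    (hs : IsDownClosed D s) (ht : IsDownClosed D t) : IsDownClosed D (s ∪ t) := by
  intro e he hex f hf hfe hD
  rcases Finset.mem_union.1 he with h | h
  · exact Finset.mem_union_left _ (hs e h hex f hf hfe hD)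
  · exact Finset.mem_union_right _ (ht e h hex f hf hfe hD)

theorem IsDownClosed.inter {D : Set (Set.Icc x y)} {s t : Finset (Fin n × Fin n)}
    (hs : IsDownClosed D s) (ht : IsDownClosed D t) : IsDownClosed D (s ∩ t) := by
  intro e he hex f hf hfe hD
  obtain ⟨h, h'⟩ := Finset.mem_inter.1 he
  exact Finset.mem_inter.2 ⟨hs e h hex f hf hfe hD, ht e h' hex f hf hfe hD⟩

/-- If the forced edge were missing, each crossing edge outside `x` would lie in some member of `D`
lacking it. The larger of two such members contains both crossing edges, hence the forced one. -/
theorem IsDownClosed.crossingClosed {D : Set (Set.Icc x y)} (hD : IsChain (· ≤ ·) D)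
    {s : Finset (Fin n × Fin n)} (hx : x.edges ⊆ s) (hy : s ⊆ y.edges) (hs : IsDownClosed D s) :
    CrossingClosed s := by
  intro i j k l hij hjk hkl h1 h2
  have hfy := y.crossing i j k l hij hjk hkl (hy h1) (hy h2)
  have hcr : ∀ d : Set.Icc x y, (i, k) ∈ d.1.edges → (j, l) ∈ d.1.edges → (j, k) ∈ d.1.edges :=
    fun d => d.1.crossing i j k l hij hjk hkl
  have key1 := fun h => hs _ h1 h _ hfy (edgeRank_lt_left hij).le
  have key2 := fun h => hs _ h2 h _ hfy (edgeRank_lt_right hkl).le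
  by_cases h1x : (i, k) ∈ x.edges
  · by_cases h2x : (j, l) ∈ x.edges
    · exact hx (x.crossing i j k l hij hjk hkl h1x h2x)
    · exact key2 h2x fun d _ h => hcr d (lower_subset d h1x) h
  · by_cases h2x : (j, l) ∈ x.edges
    · exact key1 h1x fun d _ h => hcr d h (lower_subset d h2x)
    · by_contra hf
      have hn1 := mt (key1 h1x) hf
      have hn2 := mt (key2 h2x) hf
      push Not at hn1 hn2
      obtain ⟨d, hd, hd1, hdf⟩ := hn1
      obtain ⟨d', hd', hd2, hdf'⟩ := hn2
      rcases hD.total hd hd' with h | h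
      · exact hdf' (hcr d' (Icc_le_iff.1 h hd1) hd2)
      · exact hdf (hcr d hd1 (Icc_le_iff.1 h hd2))

theorem iccLattice_inf_edges (hxy : x ≤ y) (a b : Set.Icc x y) :
    ((iccLattice hxy).inf a b).1.edges = a.1.edges ∩ b.1.edges := by
  let := iccLattice hxy
  have hc : CrossingClosed (a.1.edges ∩ b.1.edges) := fun i j k l hij hjk hkl h1 h2 =>
    Finset.mem_inter.2 ⟨a.1.crossing i j k l hij hjk hkl (Finset.mem_inter.1 h1).1
      (Finset.mem_inter.1 h2).1, b.1.crossing i j k l hij hjk hkl (Finset.mem_inter.1 h1).2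
      (Finset.mem_inter.1 h2).2⟩
  let c : Set.Icc x y := ofEdges _ (Finset.subset_inter (lower_subset a) (lower_subset b))
    (Finset.inter_subset_left.trans (subset_upper a)) hc
  have hca : c ≤ a := Icc_le_iff.2 Finset.inter_subset_left
  have hcb : c ≤ b := Icc_le_iff.2 Finset.inter_subset_right
  exact (Finset.subset_inter (Icc_le_iff.1 (inf_le_left : a ⊓ b ≤ a))
    (Icc_le_iff.1 (inf_le_right : a ⊓ b ≤ b))).antisymm (Icc_le_iff.1 (le_inf hca hcb))

/-- In general the join is larger than the union; the crossing condition on the union is what makes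
them agree. -/
theorem iccLattice_sup_edges (hxy : x ≤ y) (a b : Set.Icc x y)
    (hc : CrossingClosed (a.1.edges ∪ b.1.edges)) :
    ((iccLattice hxy).sup a b).1.edges = a.1.edges ∪ b.1.edges := by
  let := iccLattice hxy
  let c : Set.Icc x y := ofEdges _ ((lower_subset a).trans Finset.subset_union_left)
    (Finset.union_subset (subset_upper a) (subset_upper b)) hc
  have hca : a ≤ c := Icc_le_iff.2 Finset.subset_union_left
  have hcb : b ≤ c := Icc_le_iff.2 Finset.subset_union_right
  exact Finset.Subset.antisymm (Icc_le_iff.1 (sup_le hca hcb))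
    (Finset.union_subset (Icc_le_iff.1 (le_sup_left : a ≤ a ⊔ b))
      (Icc_le_iff.1 (le_sup_right : b ≤ a ⊔ b)))

theorem generatesDistributive_initialSegments (hxy : x ≤ y) {D : Set (Set.Icc x y)}
    (hD : IsChain (· ≤ ·) D) :
    @GeneratesDistributive _ (iccLattice hxy) (initialSegments x y ∪ D) := by
  let := iccLattice hxy
  let K : Set (Set.Icc x y) := {z | IsDownClosed D z.1.edges}
  have hsup : ∀ {a b}, a ∈ K → b ∈ K → (a ⊔ b).1.edges = a.1.edges ∪ b.1.edges :=
    fun {a b} ha hb => iccLattice_sup_edges hxy a b <| (ha.union hb).crossingClosed hD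
      ((lower_subset a).trans Finset.subset_union_left)
      (Finset.union_subset (subset_upper a) (subset_upper b))
  have hinf : ∀ a b : Set.Icc x y, (a ⊓ b).1.edges = a.1.edges ∩ b.1.edges :=
    iccLattice_inf_edges hxy
  have hK : IsSublattice K := by
    refine ⟨fun a ha b hb => ?_, fun a ha b hb => ?_⟩
    · change IsDownClosed D (a ⊔ b).1.edges
      rw [hsup ha hb]
      exact ha.union hb
    · change IsDownClosed D (a ⊓ b).1.edges
      rw [hinf]
      exact ha.inter hb
  have hsub : latticeClosure (initialSegments x y ∪ D) ⊆ K := by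
    refine latticeClosure_min (Set.union_subset ?_ ?_) hK
    · exact fun m hm e he hex f hf hfe _ => hm e he hex f hf hfe
    · exact fun d hd e he _ f _ _ h => h d hd he
  intro a ha b hb c hc
  replace ha := hsub ha
  replace hb := hsub hb
  replace hc := hsub hc
  refine Subtype.ext (ext_edges ?_)
  rw [hinf, hsup hb hc, hsup (hK.infClosed ha hb) (hK.infClosed ha hc), hinf, hinf,
    Finset.inter_union_distrib_left]

end Interval

end NetworkPoset

theorem mainTheorem5 (n : ℕ) (ε : Fin n → SignType) (x y : NetworkPoset n ε) (hxy : x ≤ y) :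
    IsSupersolvableLattice (Set.Icc x y) :=
  ⟨NetworkPoset.iccLattice hxy, rfl, inferInstance,
    NetworkPoset.initialSegments x y, NetworkPoset.isMaxChain_initialSegments hxy,
    fun _ hD => NetworkPoset.generatesDistributive_initialSegments hxy hD⟩
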